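/- **Syntax.** Expressions are $M,N ::= x \mid \lambda x.M \mid M\,N \mid \mathsf{let\,rec}\ D\ \mathsf{in}\ M \mid \bullet$, where $D$ is a finite (possibly empty) unordered collection of bindings $x_1=M_1,\dots,x_n=M_n$ of pairwise distinct variables, all of whose right-hand sides, like the body $M$, are in the scope of $x_1,\dots,x_n$. Expressions are taken up to $\alpha$-equivalence, and in each rule below bound variables are assumed to be renamed so that no variable is captured. A *program* is a closed expression. *Values* are $V ::= \lambda x.M \mid \bullet$, *answers* are $A ::= V \mid \mathsf{let\,rec}\ D\ \mathsf{in}\ A$, and *good answers* are $G ::= \lambda x.M \mid \mathsf{let\,rec}\ D\ \mathsf{in}\ G$. **Evaluation contexts.** In the call-by-need calculus $\lambda_{\mathit{letrec}}$, evaluation contexts $E$ and dependencies $D[x,x']$ are given by $$E ::= [\,] \mid E\,M \mid \mathsf{let\,rec}\ D\ \mathsf{in}\ E \mid \mathsf{let\,rec}\ x=E,\,D\ \mathsf{in}\ E'[x] \mid \mathsf{let\,rec}\ x'=E,\,D[x,x'],\,D\ \mathsf{in}\ E'[x],$$ $$D[x,x'] ::= x=E[x'] \mid D[x,x''],\,x''=E[x'].$$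 In the call-by-value calculus $\lambda^{\mathit{val}}_{\mathit{letrec}}$ there is the additional production $E ::= \cdots \mid V\,E$ (also for the contexts inside dependencies). For an expression $N$, $D[x,N]$ denotes $D[x,x']$ with the occurrence of $x'$ displayed in its last binding replaced by $N$. **Rules.** Both calculi have the following rules, where $E$ and $D[x,x']$ are those of the respective calculus. - *lift*: $(\mathsf{let\,rec}\ D\ \mathsf{in}\ A)\,N \mapsto \mathsf{let\,rec}\ D\ \mathsf{in}\ A\,N$. - *deref*: $\mathsf{let\,rec}\ x=V,D\ \mathsf{in}\ E[x] \mapsto \mathsf{let\,rec}\ x=V,D\ \mathsf{in}\ E[V]$. - *deref*$_{env}$: $\mathsf{let\,rec}\ D[x,x'],\,x'=V,\,D\ \mathsf{in}\ E[x] \mapsto \mathsf{let\,rec}\ D[x,V],\,x'=V,\,D\ \mathsf{in}\ E[x]$. - *assoc*: $\mathsf{let\,rec}\ x=(\mathsf{let\,rec}\ D\ \mathsf{in}\ A),\,D'\ \mathsf{in}\ E[x] \mapsto \mathsf{let\,rec}\ D,\,x=A,\,D'\ \mathsf{in}\ E[x]$. - *assoc*$_{env}$: $\mathsf{let\,rec}\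 x'=(\mathsf{let\,rec}\ D\ \mathsf{in}\ A),\,D[x,x'],\,D'\ \mathsf{in}\ E[x] \mapsto \mathsf{let\,rec}\ D,\,x'=A,\,D[x,x'],\,D'\ \mathsf{in}\ E[x]$. - *error*: $\mathsf{let\,rec}\ D[x,x],\,D\ \mathsf{in}\ E[x] \mapsto \mathsf{let\,rec}\ D[x,\bullet],\,D\ \mathsf{in}\ E[x]$. - *error*$_{env}$: $\mathsf{let\,rec}\ D[x',x'],\,D'[x,x'],\,D\ \mathsf{in}\ E[x] \mapsto \mathsf{let\,rec}\ D[x',\bullet],\,D'[x,x'],\,D\ \mathsf{in}\ E[x]$. - *error*$_\beta$: $\bullet\,M \mapsto \bullet$. The call-by-need calculus has in addition - $\beta_{need}$: $(\lambda x.M)\,N \mapsto \mathsf{let\,rec}\ x=N\ \mathsf{in}\ M$. The call-by-value calculus has instead - $\beta_{value}$: $(\lambda x.M)\,(\lambda x'.M') \mapsto \mathsf{let\,rec}\ x=\lambda x'.M'\ \mathsf{in}\ M$, - *lift*$_{arg}$: $V\,(\mathsf{let\,rec}\ D\ \mathsf{in}\ A) \mapsto \mathsf{let\,rec}\ D\ \mathsf{in}\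 V\,A$, - *error*$_{arg}$: $(\lambda x.M)\,\bullet \mapsto \bullet$. In each calculus $E[R]$ reduces in one step to $E[R']$ whenever $R\mapsto R'$. The reflexive and transitive closures of one-step reduction are written $\twoheadrightarrow_{\mathsf{need}}$ and $\twoheadrightarrow_{\mathsf{value}}$. **Proposition.** For every program $M$ and every good answer $G$, if $M \twoheadrightarrow_{\mathsf{value}} G$, then there is a good answer $G'$ such that $M \twoheadrightarrow_{\mathsf{need}} G'$. -/

import Mathlib

/-!
# The call-by-need and the call-by-value letrec calculi

Both reduction semantics work with alpha-equivalence classes of expressions. These are represented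
by nameless terms: a variable is a number that counts the enclosing bound variables between its
occurrence and its binder. No order of the bindings of a `let rec` is used by any rule.
-/

namespace Letrec

/-- Expressions `M, N ::= x | λx.M | M N | let rec D in M | ●`. -/
inductive Exp : Type
  /-- A variable. -/
  | var (i : ℕ) : Exp
  /-- An abstraction: index `0` of the body is the bound variable. -/
  | lam (M : Exp) : Exp
  /-- An application. -/
  | app (M N : Exp) : Exp
  /-- `let rec x₀ = D 0, …, xₙ₋₁ = D (n-1) in M`. In `M` and in every `D j`, an index `i < n` is
  the variable `xᵢ`, and an index `n + i` is the variable `i` of the surrounding scope. -/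
  | letrec (n : ℕ) (D : Fin n → Exp) (M : Exp) : Exp
  /-- The black hole `●`. -/
  | bh : Exp

namespace Exp

/-- The renaming `f` carried under `n` binders. -/
def under (n : ℕ) (f : ℕ → ℕ) (i : ℕ) : ℕ := if i < n then i else f (i - n) + n

/-- Renaming of the free variables. -/
def rename : (ℕ → ℕ) → Exp → Exp
  | f, var i => var (f i)
  | f, lam M => lam (rename (under 1 f) M)
  | f, app M N => app (rename f M) (rename f N)
  | f, letrec n D M => letrec n (fun j => rename (under n f) (D j)) (rename (under n f) M)
  | _, bh => bh

/-- The expression `M` seen from below `k` additional binders, none of which occurs in `M`. -/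
def shift (k : ℕ) (M : Exp) : Exp := rename (fun i => i + k) M

/-- Free variables. -/
def fv : Exp → Set ℕ
  | var i => {i}
  | lam M => {i | i + 1 ∈ fv M}
  | app M N => fv M ∪ fv N
  | letrec n D M => {i | i + n ∈ (⋃ j, fv (D j)) ∪ fv M}
  | bh => ∅

/-- A program is a closed expression. -/
def IsProgram (M : Exp) : Prop := fv M = ∅

/-- Values `V ::= λx.M | ●`. -/
inductive IsValue : Exp → Prop
  | lam (M : Exp) : IsValue (lam M)
  | bh : IsValue bh

/-- Answers `A ::= V | let rec D in A`. -/
inductive IsAnswer : Exp → Prop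
  | value {V : Exp} : IsValue V → IsAnswer V
  | letrec (n : ℕ) (D : Fin n → Exp) {A : Exp} : IsAnswer A → IsAnswer (letrec n D A)

/-- Good answers `G ::= λx.M | let rec D in G`. -/
inductive IsGoodAnswer : Exp → Prop
  | lam (M : Exp) : IsGoodAnswer (lam M)
  | letrec (n : ℕ) (D : Fin n → Exp) {G : Exp} : IsGoodAnswer G → IsGoodAnswer (letrec n D G)

end Exp

open Exp

/-- One-hole contexts. The evaluation contexts are singled out by `IsEval` below. -/
inductive Ctx : Type
  | hole : Ctx
  /-- `E M` -/
  | appL (E : Ctx) (M : Exp) : Ctx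
  /-- `M E` -/
  | appR (M : Exp) (E : Ctx) : Ctx
  /-- `let rec D in E` -/
  | letBody (n : ℕ) (D : Fin n → Exp) (E : Ctx) : Ctx
  /-- `let rec xᵢ = E, D in M`, where `D` is the family without its `i`-th member, which is
  ignored. -/
  | letDef (n : ℕ) (D : Fin n → Exp) (i : Fin n) (E : Ctx) (M : Exp) : Ctx

namespace Ctx

/-- The number of binders above the hole. -/
def depth : Ctx → ℕ
  | hole => 0
  | appL E _ => depth E
  | appR _ E => depth E
  | letBody n _ E => depth E + n
  | letDef n _ _ E _ => depth E + n

/-- Filling the hole with an expression of the scope of the hole. -/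
def fill : Ctx → Exp → Exp
  | hole, N => N
  | appL E M, N => app (fill E N) M
  | appR M E, N => app M (fill E N)
  | letBody n D E, N => letrec n D (fill E N)
  | letDef n D i E M, N => letrec n (Function.update D i (fill E N)) M

/-- `E[M]` for an expression `M` of the scope in which `E` itself stands: the binders of `E` do not
capture the variables of `M`. -/
def plug (E : Ctx) (M : Exp) : Exp := fill E (shift E.depth M)

end Ctx

/-- The two calculi. -/
inductive Strategy : Type
  | need : Strategy
  | value : Strategy

/-- Evaluation contexts

`E ::= [] | E M | let rec D in E | let rec x = E, D in E'[x] | let rec x' = E, D[x,x'], D in E'[x]`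

and, in the call-by-value calculus, also `V E`. A dependency `D[x,x']` is a collection of bindings
`x = F₀[x₁], x₁ = F₁[x₂], …, xₘ₋₁ = Fₘ₋₁[x']` of distinct variables, with `Fᵢ` evaluation contexts.
The constructor `dep` with `m = 0` is the fourth production, and with `m > 0` the fifth. Only the
values of `x` at `0, …, m` and of `F` at `0, …, m - 1` are used. -/
inductive IsEval (s : Strategy) : Ctx → Prop
  | hole : IsEval s Ctx.hole
  | appL {E : Ctx} (M : Exp) : IsEval s E → IsEval s (Ctx.appL E M)
  | appR {V : Exp} {E : Ctx} : s = Strategy.value → IsValue V → IsEval s E →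
      IsEval s (Ctx.appR V E)
  | letBody (n : ℕ) (D : Fin n → Exp) {E : Ctx} : IsEval s E → IsEval s (Ctx.letBody n D E)
  | dep {n : ℕ} (D : Fin n → Exp) (m : ℕ) (x : ℕ → Fin n) (F : ℕ → Ctx) {E E' : Ctx} :
      (∀ i j, i ≤ m → j ≤ m → x i = x j → i = j) →
      (∀ i, i < m → IsEval s (F i)) →
      (∀ i, i < m → D (x i) = (F i).plug (var (x (i + 1)))) →
      IsEval s E → IsEval s E' →
      IsEval s (Ctx.letDef n D (x m) E (E'.plug (var (x 0))))

/-- The variables `x 0, …, x m` are distinct and, for `i < m`, the binding of `x i` in `D` is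
`x i = F[x (i+1)]` for an evaluation context `F`. -/
def IsPath (s : Strategy) {n : ℕ} (D : Fin n → Exp) (m : ℕ) (x : ℕ → Fin n) : Prop :=
  (∀ i j, i ≤ m → j ≤ m → x i = x j → i = j) ∧
  ∀ i, i < m → ∃ F, IsEval s F ∧ D (x i) = Ctx.plug F (var (x (i + 1)))

/-- For `xᵢ` bound in `D` to `let rec D₁ in A`, the expression `let rec D₁, xᵢ = A, D' in M`, where
`D'` consists of the other bindings of `D`. The bindings of `D₁` come first, so that `D₁` and `A`
need no renaming. -/
def flatten {n : ℕ} (D : Fin n → Exp) (M : Exp) (i : Fin n) {k : ℕ} (D₁ : Fin k → Exp) (A : Exp) :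
    Exp :=
  letrec (k + n) (Fin.append D₁ (Function.update (fun j => shift k (D j)) i A)) (shift k M)

/-- The reduction rules. -/
inductive Redex (s : Strategy) : Exp → Exp → Prop
  /-- `(λx.M) N ↦ let rec x = N in M`, in the call-by-need calculus. -/
  | beta_need (M N : Exp) : s = Strategy.need →
      Redex s (app (lam M) N) (letrec 1 (fun _ => shift 1 N) M)
  /-- `(λx.M) (λx'.M') ↦ let rec x = λx'.M' in M`, in the call-by-value calculus. -/
  | beta_value (M M' : Exp) : s = Strategy.value →
      Redex s (app (lam M) (lam M')) (letrec 1 (fun _ => shift 1 (lam M')) M)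
  /-- `(let rec D in A) N ↦ let rec D in A N` -/
  | lift (n : ℕ) (D : Fin n → Exp) (A N : Exp) : IsAnswer A →
      Redex s (app (letrec n D A) N) (letrec n D (app A (shift n N)))
  /-- `V (let rec D in A) ↦ let rec D in V A`, in the call-by-value calculus. -/
  | lift_arg (V : Exp) (n : ℕ) (D : Fin n → Exp) (A : Exp) : s = Strategy.value →
      IsValue V → IsAnswer A →
      Redex s (app V (letrec n D A)) (letrec n D (app (shift n V) A))
  /-- `let rec x = V, D in E[x] ↦ let rec x = V, D in E[V]` -/
  | deref {n : ℕ} (D : Fin n → Exp) (x : Fin n) (E : Ctx) : IsEval s E → IsValue (D x) →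
      Redex s (letrec n D (E.plug (var x))) (letrec n D (E.plug (D x)))
  /-- `let rec D[x,x'], x' = V, D in E[x] ↦ let rec D[x,V], x' = V, D in E[x]`, where `D[x,x']` binds
  `x = x 0, …, x m`, the last of them to `F[x']`. -/
  | deref_env {n : ℕ} (D : Fin n → Exp) (m : ℕ) (x : ℕ → Fin n) (x' : Fin n) (F E : Ctx) :
      IsEval s E → IsPath s D m x → IsEval s F → D (x m) = F.plug (var x') →
      (∀ i, i ≤ m → x i ≠ x') → IsValue (D x') →
      Redex s (letrec n D (E.plug (var (x 0))))
        (letrec n (Function.update D (x m) (F.plug (D x'))) (E.plug (var (x 0))))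
  /-- `let rec x = (let rec D in A), D' in E[x] ↦ let rec D, x = A, D' in E[x]` -/
  | assoc {n : ℕ} (D : Fin n → Exp) (x : Fin n) (E : Ctx) (k : ℕ) (D₁ : Fin k → Exp) (A : Exp) :
      IsEval s E → IsAnswer A → D x = letrec k D₁ A →
      Redex s (letrec n D (E.plug (var x))) (flatten D (E.plug (var x)) x D₁ A)
  /-- `let rec x' = (let rec D in A), D[x,x'], D' in E[x] ↦ let rec D, x' = A, D[x,x'], D' in E[x]`,
  where `x = x 0` and `x' = x m`. -/
  | assoc_env {n : ℕ} (D : Fin n → Exp) (m : ℕ) (x : ℕ → Fin n) (E : Ctx) (k : ℕ)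
      (D₁ : Fin k → Exp) (A : Exp) :
      IsEval s E → 0 < m → IsPath s D m x → IsAnswer A → D (x m) = letrec k D₁ A →
      Redex s (letrec n D (E.plug (var (x 0)))) (flatten D (E.plug (var (x 0))) (x m) D₁ A)
  /-- `let rec D[x,x], D in E[x] ↦ let rec D[x,●], D in E[x]`, where `D[x,x]` binds
  `x = x 0, …, x m`, the last of them to `F[x]`. -/
  | error {n : ℕ} (D : Fin n → Exp) (m : ℕ) (x : ℕ → Fin n) (F E : Ctx) :
      IsEval s E → IsPath s D m x → IsEval s F → D (x m) = F.plug (var (x 0)) →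
      Redex s (letrec n D (E.plug (var (x 0))))
        (letrec n (Function.update D (x m) (F.plug bh)) (E.plug (var (x 0))))
  /-- `let rec D[x',x'], D'[x,x'], D in E[x] ↦ let rec D[x',●], D'[x,x'], D in E[x]`, where `D'[x,x']`
  binds `x = x 0, …, x (j-1)`, and `D[x',x']` binds `x' = x j, …, x m`, the last of them to
  `F[x']`. -/
  | error_env {n : ℕ} (D : Fin n → Exp) (m : ℕ) (x : ℕ → Fin n) (j : ℕ) (F E : Ctx) :
      IsEval s E → 0 < j → j ≤ m → IsPath s D m x → IsEval s F →
      D (x m) = F.plug (var (x j)) →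
      Redex s (letrec n D (E.plug (var (x 0))))
        (letrec n (Function.update D (x m) (F.plug bh)) (E.plug (var (x 0))))
  /-- `● M ↦ ●` -/
  | error_beta (M : Exp) : Redex s (app bh M) bh
  /-- `(λx.M) ● ↦ ●`, in the call-by-value calculus. -/
  | error_arg (M : Exp) : s = Strategy.value → Redex s (app (lam M) bh) bh

/-- One-step reduction: `E[R]` reduces to `E[R']` if `R ↦ R'`. -/
def Step (s : Strategy) (M N : Exp) : Prop :=
  ∃ (E : Ctx) (R R' : Exp), IsEval s E ∧ Redex s R R' ∧ M = E.fill R ∧ N = E.fill R'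

/-- The reflexive and transitive closure of one-step reduction. -/
def Steps (s : Strategy) : Exp → Exp → Prop := Relation.ReflTransGen (Step s)

end Letrec

/-!
# A filter model of the letrec calculi

Expressions denote sets of types with costs. The parameter `t` is the cost of an application: with
`t = 0` the model is invariant under beta reduction, with `t = 1` every beta reduction in an
evaluation context lowers the cost.
-/

namespace Letrec

/-! The proof compares the two calculi through one denotational model instead of simulating
reductions. An expression denotes the set of its intersection types, `let rec` being a least fixed
point, and application costs `t`.

At `t = 0`, every type of a call-by-value reduct is already a type of the source
(`Steps.den_value`). A good answer has the type `base 0`, hence so has `M`. Only this inclusion is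
needed, so it does no harm that the error rules of call-by-value may lose types.

A logical relation (`Realizes`, `realizes_den`) carries this over to the model at `t = 1`: `M` has
the type `base c` for some `c`. There a call-by-need step keeps all types, and it either lowers the
`weight` of the expression or, for beta, lowers the cost of every type by one (`Step.den_need`).
Lowering the cost works because the call-by-need evaluation contexts pass the saving on to the whole
expression (`StrictRel.den_fill`). So reduction terminates lexicographically in `(c, weight)`. By
`progress` it ends in an answer or in an expression that demands a free variable. The latter, and
the answers that end in the black hole, have no types in the empty environment, so what remains is a
good answer. -/

/-- Types, each with a cost. The type `base c` is that of the expressions that evaluate to an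
abstraction, and `arr n A τ c` that of the functions that send the arguments with all the types
`A i` to results of type `τ`. -/
inductive Ty : Type
  | base (c : ℕ) : Ty
  | arr (n : ℕ) (A : Fin n → Ty) (τ : Ty) (c : ℕ) : Ty

namespace Ty

/-- Add `k` to the cost of a type. -/
def raise (k : ℕ) : Ty → Ty
  | base c => base (c + k)
  | arr n A τ c => arr n A τ (c + k)

theorem raise_raise (k l : ℕ) (τ : Ty) : raise k (raise l τ) = raise (l + k) τ := by
  cases τ <;> simp [raise, Nat.add_assoc]

@[simp] theorem raise_zero (τ : Ty) : raise 0 τ = τ := by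
  cases τ <;> simp [raise]

end Ty

open Exp Ty

/-- Assignments of sets of types to the variables. -/
abbrev Env : Type := ℕ → Set Ty

/-- The closure of a set of types under the increase of costs. -/
def up (S : Set Ty) : Set Ty := {ν | ∃ τ ∈ S, ∃ k, ν = raise k τ}

/-- Sets of types that are closed under the increase of costs. -/
def IsUp (S : Set Ty) : Prop := ∀ τ ∈ S, ∀ k, raise k τ ∈ S

theorem subset_up (S : Set Ty) : S ⊆ up S := fun τ h => ⟨τ, h, 0, by simp⟩

theorem up_mono {S T : Set Ty} (h : S ⊆ T) : up S ⊆ up T :=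
  fun _ ⟨τ, hτ, k, e⟩ => ⟨τ, h hτ, k, e⟩

theorem isUp_up (S : Set Ty) : IsUp (up S) := by
  rintro _ ⟨τ, hτ, l, rfl⟩ k
  exact ⟨τ, hτ, l + k, raise_raise _ _ _⟩

theorem IsUp.up_eq {S : Set Ty} (h : IsUp S) : up S = S := by
  refine Set.Subset.antisymm ?_ (subset_up S)
  rintro _ ⟨τ, hτ, k, rfl⟩
  exact h τ hτ k

/-- Application of sets of types, at the cost `t`. -/
def appl (t : ℕ) (S Y : Set Ty) : Set Ty :=
  {ν | ∃ n A τ c, arr n A τ c ∈ S ∧ (∀ i, A i ∈ Y) ∧ ν = raise (c + t) τ}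

theorem appl_mono {t : ℕ} {S S' Y Y' : Set Ty} (h : S ⊆ S') (h' : Y ⊆ Y') :
    appl t S Y ⊆ appl t S' Y' :=
  fun _ ⟨n, A, τ, c, hS, hA, e⟩ => ⟨n, A, τ, c, h hS, fun i => h' (hA i), e⟩

theorem appl_empty (t : ℕ) (Y : Set Ty) : appl t ∅ Y = ∅ := by
  ext ν
  simp [appl]

theorem IsUp.appl {t : ℕ} {S Y : Set Ty} (h : IsUp S) : IsUp (appl t S Y) := by
  rintro _ ⟨n, A, τ, c, hS, hA, rfl⟩ k
  refine ⟨n, A, τ, c + k, h _ hS k, hA, ?_⟩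
  rw [raise_raise]
  congr 1
  omega

/-! ### Environments -/

/-- The environment `ρ` under `n` binders that denote `X`. -/
def ext {n : ℕ} (X : Fin n → Set Ty) (ρ : Env) : Env :=
  fun i => if h : i < n then X ⟨i, h⟩ else ρ (i - n)

/-- The environment outside of the `n` innermost binders. -/
def drop (n : ℕ) (ρ : Env) : Env := fun i => ρ (i + n)

@[simp] theorem ext_val {n : ℕ} (X : Fin n → Set Ty) (ρ : Env) (i : Fin n) :
    ext X ρ i = X i := by
  simp [ext]

@[simp] theorem ext_add {n : ℕ} (X : Fin n → Set Ty) (ρ : Env) (i : ℕ) :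
    ext X ρ (i + n) = ρ i := by
  simp [ext]

@[simp] theorem drop_ext {n : ℕ} (X : Fin n → Set Ty) (ρ : Env) : drop n (ext X ρ) = ρ := by
  funext i
  simp [drop]

theorem drop_add (m n : ℕ) (ρ : Env) : drop (m + n) ρ = drop n (drop m ρ) := by
  funext i
  simp only [drop]
  congr 1
  omega

theorem ext_mono {n : ℕ} {X Y : Fin n → Set Ty} {ρ σ : Env} (h : X ≤ Y) (h' : ρ ≤ σ) :
    ext X ρ ≤ ext Y σ := by
  intro i
  unfold ext
  split
  · exact h _
  · exact h' _

theorem ext_under {n : ℕ} (X : Fin n → Set Ty) (ρ : Env) (f : ℕ → ℕ) :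
    ext X ρ ∘ under n f = ext X (ρ ∘ f) := by
  funext i
  by_cases h : i < n <;> simp [ext, under, h]

theorem ext_append {k n : ℕ} (Z : Fin k → Set Ty) (X : Fin n → Set Ty) (ρ : Env) :
    ext (Fin.append Z X) ρ = ext Z (ext X ρ) := by
  funext i
  by_cases h : i < k
  · have h' : i < k + n := by omega
    have e : (⟨i, h'⟩ : Fin (k + n)) = Fin.castAdd n ⟨i, h⟩ := rfl
    simp [ext, h, h', e, - Fin.castAdd_mk]
  · by_cases h' : i < k + n
    · have e : (⟨i, h'⟩ : Fin (k + n)) = Fin.natAdd k ⟨i - k, by omega⟩ := by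
        ext
        simp
        omega
      have h'' : i - k < n := by omega
      simp only [ext, h, h', h'', dif_pos, dif_neg, not_false_eq_true, e, Fin.append_right]
    · have h'' : ¬ i - k < n := by omega
      simp [ext, h, h', h'', Nat.sub_sub]

/-! ### Least fixed points and the interpretation of expressions -/

/-- The least prefixed point of an operator on families of sets of types. -/
def lfix {n : ℕ} (Φ : (Fin n → Set Ty) → Fin n → Set Ty) : Fin n → Set Ty := sInf {X | Φ X ≤ X}

theorem lfix_le {n : ℕ} {Φ : (Fin n → Set Ty) → Fin n → Set Ty} {X : Fin n → Set Ty}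
    (h : Φ X ≤ X) : lfix Φ ≤ X :=
  sInf_le h

theorem lfix_eq {n : ℕ} {Φ : (Fin n → Set Ty) → Fin n → Set Ty} (hΦ : Monotone Φ) :
    Φ (lfix Φ) = lfix Φ :=
  OrderHom.map_lfp ⟨Φ, hΦ⟩

/-- The set of the types of an expression. -/
def den (t : ℕ) : Exp → Env → Set Ty
  | var i, ρ => up (ρ i)
  | lam M, ρ => {ν | (∃ c, ν = base c) ∨
      ∃ n A τ c, ν = arr n A τ c ∧ τ ∈ den t M (ext (fun _ : Fin 1 => Set.range A) ρ)}
  | app M N, ρ => appl t (den t M ρ) (den t N ρ)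
  | letrec _ D M, ρ => den t M (ext (lfix fun X i => den t (D i) (ext X ρ)) ρ)
  | bh, _ => ∅

/-- The sets of types of the variables bound by the definitions `D`. -/
def defs (t : ℕ) {n : ℕ} (D : Fin n → Exp) (ρ : Env) : Fin n → Set Ty :=
  lfix fun X i => den t (D i) (ext X ρ)

theorem den_letrec (t : ℕ) {n : ℕ} (D : Fin n → Exp) (M : Exp) (ρ : Env) :
    den t (letrec n D M) ρ = den t M (ext (defs t D ρ) ρ) := rfl

theorem defs_le {t n : ℕ} {D : Fin n → Exp} {ρ : Env} {X : Fin n → Set Ty}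
    (h : ∀ i, den t (D i) (ext X ρ) ⊆ X i) : defs t D ρ ≤ X :=
  lfix_le h

theorem den_mono (t : ℕ) (M : Exp) : Monotone (den t M) := by
  induction M with
  | var i => exact fun ρ σ h => up_mono (h i)
  | lam M ih =>
    rintro ρ σ h ν (hν | ⟨n, A, τ, c, e, hτ⟩)
    · exact Or.inl hν
    · exact Or.inr ⟨n, A, τ, c, e, ih (ext_mono le_rfl h) hτ⟩
  | app M N ihM ihN => exact fun ρ σ h => appl_mono (ihM h) (ihN h)
  | letrec n D M ihD ihM =>
    have key : ∀ ρ : Env, Monotone fun (X : Fin n → Set Ty) i => den t (D i) (ext X ρ) :=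
      fun ρ X Y h i => ihD i (ext_mono h le_rfl)
    intro ρ σ h
    refine ihM (ext_mono (lfix_le ?_) h)
    intro i
    refine le_trans (ihD i (ext_mono le_rfl h)) ?_
    exact (congrFun (lfix_eq (key σ)) i).le
  | bh => exact fun _ _ _ => le_rfl

theorem den_defs (t : ℕ) {n : ℕ} (D : Fin n → Exp) (ρ : Env) (i : Fin n) :
    den t (D i) (ext (defs t D ρ) ρ) = defs t D ρ i :=
  congrFun (lfix_eq fun _ _ h j => den_mono t (D j) (ext_mono h le_rfl)) i

theorem defs_mono (t : ℕ) {n : ℕ} (D : Fin n → Exp) : Monotone (defs t D) := fun _ σ h =>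
  defs_le fun i => (den_mono t (D i) (ext_mono le_rfl h)).trans (den_defs t D σ i).le

theorem isUp_den (t : ℕ) (M : Exp) (ρ : Env) : IsUp (den t M ρ) := by
  induction M generalizing ρ with
  | var i => exact isUp_up _
  | lam M ih =>
    rintro _ (⟨c, rfl⟩ | ⟨n, A, τ, c, rfl, hτ⟩) k
    · exact Or.inl ⟨_, rfl⟩
    · exact Or.inr ⟨n, A, τ, _, rfl, hτ⟩
  | app M N ihM ihN => exact (ihM ρ).appl
  | letrec n D M ihD ihM => exact ihM _
  | bh => exact fun _ h => h.elim

/-- The closure `up` in the clause for variables adds nothing here: a component of the fixed point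
is itself a denotation, so it is already closed under the increase of costs. -/
theorem den_var_defs (t : ℕ) {n : ℕ} (D : Fin n → Exp) (ρ : Env) (i : Fin n) :
    den t (var i) (ext (defs t D ρ) ρ) = defs t D ρ i := by
  have h := isUp_den t (D i) (ext (defs t D ρ) ρ)
  rw [den_defs] at h
  simp [den, h.up_eq]

theorem den_rename (t : ℕ) (M : Exp) (f : ℕ → ℕ) (ρ : Env) :
    den t (rename f M) ρ = den t M (ρ ∘ f) := by
  induction M generalizing f ρ with
  | var i => rfl
  | lam M ih => simp only [rename, den, ih, ext_under]
  | app M N ihM ihN => simp only [rename, den, ihM, ihN]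
  | letrec n D M ihD ihM => simp only [rename, den, ihM, ihD, ext_under]
  | bh => rfl

theorem den_shift (t k : ℕ) (M : Exp) (ρ : Env) : den t (shift k M) ρ = den t M (drop k ρ) :=
  den_rename t M _ ρ

theorem den_shift_ext (t : ℕ) {k : ℕ} (M : Exp) (X : Fin k → Set Ty) (ρ : Env) :
    den t (shift k M) (ext X ρ) = den t M ρ := by
  rw [den_shift, drop_ext]

/-! ### Contexts -/

/-- The hole may lie inside a recursive definition, and then the two fillings give the bound
variables different denotations. This is why the hypothesis ranges over pairs `η ≤ η'` of extensions
of `ρ` and `ρ'`. -/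
theorem den_fill_mono {t : ℕ} (E : Ctx) {N N' : Exp} {ρ ρ' : Env} (hρ : ρ ≤ ρ')
    (h : ∀ η η', η ≤ η' → drop E.depth η = ρ → drop E.depth η' = ρ' →
      den t N η ⊆ den t N' η') :
    den t (E.fill N) ρ ⊆ den t (E.fill N') ρ' := by
  induction E generalizing ρ ρ' with
  | hole => exact h ρ ρ' hρ rfl rfl
  | appL E M ih => exact appl_mono (ih hρ h) (den_mono t M hρ)
  | appR M E ih => exact appl_mono (den_mono t M hρ) (ih hρ h)
  | letBody n D E ih =>
    refine ih (ext_mono (defs_mono t D hρ) hρ) fun η η' hη e e' => h η η' hη ?_ ?_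
    · rw [Ctx.depth, drop_add, e, drop_ext]
    · rw [Ctx.depth, drop_add, e', drop_ext]
  | letDef n D i E M ih =>
    refine den_mono t M (ext_mono (defs_le fun j => ?_) hρ)
    refine subset_trans ?_ (den_defs t _ ρ' j).le
    by_cases hj : j = i
    · subst hj
      simp only [Function.update_self]
      refine ih (ext_mono le_rfl hρ) fun η η' hη e e' => h η η' hη ?_ ?_
      · rw [Ctx.depth, drop_add, e, drop_ext]
      · rw [Ctx.depth, drop_add, e', drop_ext]
    · simp only [Function.update_of_ne hj]
      exact den_mono t (D j) (ext_mono le_rfl hρ)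

theorem den_plug_mono {t : ℕ} (E : Ctx) {N N' : Exp} {ρ : Env}
    (h : den t N ρ ⊆ den t N' ρ) : den t (E.plug N) ρ ⊆ den t (E.plug N') ρ :=
  den_fill_mono E le_rfl fun η η' _ e e' => by rwa [den_shift, den_shift, e, e']

theorem den_plug_congr {t : ℕ} (E : Ctx) {N N' : Exp} {ρ : Env}
    (h : den t N ρ = den t N' ρ) : den t (E.plug N) ρ = den t (E.plug N') ρ :=
  (den_plug_mono E h.le).antisymm (den_plug_mono E h.ge)

/-- Relations between sets of types that are preserved by the call-by-need evaluation contexts. -/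
structure StrictRel (t : ℕ) (R : Set Ty → Set Ty → Prop) : Prop where
  le : ∀ {S T}, R S T → S ⊆ T
  appl : ∀ {S T Y Y'}, R S T → Y ⊆ Y' → R (appl t S Y) (appl t T Y')

/-- Evaluation contexts consist of function positions, `let rec` bodies and chains of demanded
bindings. Used with `strictRel_empty` for strictness and with `strictRel_tick` for the cost of beta.
-/
theorem StrictRel.den_fill {t : ℕ} {R : Set Ty → Set Ty → Prop} (hR : StrictRel t R) {E : Ctx}
    (hE : IsEval .need E) {N N' : Exp} {ρ ρ' : Env} (hρ : ρ ≤ ρ')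
    (h : ∀ η η', η ≤ η' → drop E.depth η = ρ → drop E.depth η' = ρ' →
      R (den t N η) (den t N' η')) :
    R (den t (E.fill N) ρ) (den t (E.fill N') ρ') := by
  induction hE generalizing N N' ρ ρ' with
  | hole => exact h ρ ρ' hρ rfl rfl
  | appL M _ ih => exact hR.appl (ih hρ h) (den_mono t M hρ)
  | appR hs _ _ _ => cases hs
  | letBody n D _ ih =>
    refine ih (ext_mono (defs_mono t D hρ) hρ) fun η η' hη e e' => h η η' hη ?_ ?_
    · rw [Ctx.depth, drop_add, e, drop_ext]
    · rw [Ctx.depth, drop_add, e', drop_ext]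
  | @dep n D m x F E E' hx hF hD _ _ ihF ihE ihE' =>
    have h' : ∀ (X X' : Fin n → Set Ty) η η', η ≤ η' → drop E.depth η = ext X ρ →
        drop E.depth η' = ext X' ρ' → R (den t N η) (den t N' η') := by
      refine fun X X' η η' hη e e' => h η η' hη ?_ ?_
      · rw [Ctx.depth, drop_add, e, drop_ext]
      · rw [Ctx.depth, drop_add, e', drop_ext]
    set D₁ := Function.update D (x m) (E.fill N) with hD₁
    set D₂ := Function.update D (x m) (E.fill N') with hD₂
    have hle : ext (defs t D₁ ρ) ρ ≤ ext (defs t D₂ ρ') ρ' := by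
      refine ext_mono (defs_le fun j => ?_) hρ
      refine subset_trans ?_ (den_defs t D₂ ρ' j).le
      by_cases hj : j = x m
      · subst hj
        simp only [hD₁, hD₂, Function.update_self]
        exact den_fill_mono E (ext_mono le_rfl hρ) fun η η' hη e e' => hR.le (h' _ _ η η' hη e e')
      · simp only [hD₁, hD₂, Function.update_of_ne hj]
        exact den_mono t (D j) (ext_mono le_rfl hρ)
    have hplug : ∀ {C : Ctx} (i : Fin n), (∀ {N N' : Exp} {ρ ρ' : Env}, ρ ≤ ρ' →
          (∀ η η', η ≤ η' → drop C.depth η = ρ → drop C.depth η' = ρ' →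
            R (den t N η) (den t N' η')) → R (den t (C.fill N) ρ) (den t (C.fill N') ρ')) →
        R (defs t D₁ ρ i) (defs t D₂ ρ' i) →
        R (den t (C.plug (var i)) (ext (defs t D₁ ρ) ρ))
          (den t (C.plug (var i)) (ext (defs t D₂ ρ') ρ')) := by
      intro C i hC hi
      refine hC hle fun η η' _ e e' => ?_
      rwa [den_shift, den_shift, e, e', den_var_defs, den_var_defs]
    -- The relation travels backwards along the dependency: it enters at `x m`, whose definition
    -- contains the hole, and each `x i` demands `x (i + 1)`, until it reaches the variable `x 0`
    -- demanded by the body.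
    have hpath : ∀ k ≤ m, R (defs t D₁ ρ (x (m - k))) (defs t D₂ ρ' (x (m - k))) := by
      intro k
      induction k with
      | zero =>
        intro _
        rw [Nat.sub_zero, ← den_defs t D₁ ρ, ← den_defs t D₂ ρ']
        simp only [hD₁, hD₂, Function.update_self] at hle ⊢
        exact ihE hle (h' _ _)
      | succ k ihk =>
        intro hk
        have hi : m - (k + 1) < m := by omega
        have hne : x (m - (k + 1)) ≠ x m := fun e => by
          have := hx _ _ (by omega) le_rfl e
          omega
        have e : m - (k + 1) + 1 = m - k := by omega
        rw [← den_defs t D₁ ρ, ← den_defs t D₂ ρ']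
        have e₁ : D₁ (x (m - (k + 1))) = (F (m - (k + 1))).plug (var (x (m - k))) := by
          rw [hD₁, Function.update_of_ne hne, hD _ hi, e]
        have e₂ : D₂ (x (m - (k + 1))) = (F (m - (k + 1))).plug (var (x (m - k))) := by
          rw [hD₂, Function.update_of_ne hne, hD _ hi, e]
        rw [e₁, e₂]
        exact hplug _ (ihF _ hi) (ihk (by omega))
    have h0 := hpath m le_rfl
    rw [Nat.sub_self] at h0
    exact hplug _ ihE' h0

theorem strictRel_empty (t : ℕ) : StrictRel t fun S _ => S = ∅ where
  le := fun h => h ▸ Set.empty_subset _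
  appl := by
    rintro _ _ _ _ rfl _
    exact appl_empty _ _

/-- The cost of an arrow is added to the cost of the result, so a saving on the function is a saving
on the application. -/
theorem strictRel_tick (t : ℕ) :
    StrictRel t fun S T => S ⊆ T ∧ ∀ ν ∈ S, ∃ μ ∈ T, ν = raise 1 μ where
  le := fun h => h.1
  appl := by
    rintro S T Y Y' ⟨h, h'⟩ hY
    refine ⟨appl_mono h hY, ?_⟩
    rintro _ ⟨n, A, τ, c, hS, hA, rfl⟩
    obtain ⟨μ, hμ, e⟩ := h' _ hS
    cases μ with
    | base c => simp [raise] at e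
    | arr n' A' τ' c' =>
      simp only [raise, arr.injEq] at e
      obtain ⟨rfl, e, rfl, rfl⟩ := e
      obtain rfl := eq_of_heq e
      refine ⟨raise (c' + t) τ, ⟨n, A, τ, c', hμ, fun i => hY (hA i), rfl⟩, ?_⟩
      rw [raise_raise]
      congr 1
      omega

theorem den_plug_var_eq_empty {t : ℕ} {E : Ctx} (hE : IsEval .need E) {ρ : Env} {i : ℕ}
    (h : ρ i = ∅) : den t (E.plug (var i)) ρ = ∅ :=
  -- The relation ignores its second set, so `bh` and the second environment are arbitrary.
  (strictRel_empty t).den_fill hE (ρ' := ρ) (N' := bh) le_rfl fun η _ _ e _ => by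
    rw [den_shift, e]
    simp [den, h, up]

/-! ### Continuity -/

theorem exists_finite_forall {α ι : Type*} [Finite ι] {G : Set α} {Q : ι → Set α → Prop}
    (hQ : ∀ i s s', s ⊆ s' → Q i s → Q i s') (h : ∀ i, ∃ s, s.Finite ∧ s ⊆ G ∧ Q i s) :
    ∃ s, s.Finite ∧ s ⊆ G ∧ ∀ i, Q i s := by
  choose s hs hG hq using h
  exact ⟨⋃ i, s i, Set.finite_iUnion hs, Set.iUnion_subset hG,
    fun i => hQ i _ _ (Set.subset_iUnion s i) (hq i)⟩

/-- The environment with a given graph. -/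
def envOf (s : Set (ℕ × Ty)) : Env := fun i => {τ | (i, τ) ∈ s}

/-- The graph of an environment. -/
def graph (ρ : Env) : Set (ℕ × Ty) := {p | p.2 ∈ ρ p.1}

theorem envOf_mono : Monotone envOf := fun _ _ h _ _ hτ => h hτ

/-- A type of an expression depends on finitely many types of its variables. This is needed because
an arrow has only finitely many argument types. -/
theorem exists_finite_mem_den {t : ℕ} {M : Exp} {ρ : Env} {ν : Ty} (h : ν ∈ den t M ρ) :
    ∃ s, s.Finite ∧ s ⊆ graph ρ ∧ ν ∈ den t M (envOf s) := by
  induction M generalizing ρ ν with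
  | var i =>
    obtain ⟨τ, hτ, k, rfl⟩ := h
    refine ⟨{(i, τ)}, Set.finite_singleton _, ?_, τ, rfl, k, rfl⟩
    rintro _ rfl
    exact hτ
  | lam M ih =>
    obtain ⟨c, rfl⟩ | ⟨n, A, τ, c, rfl, hτ⟩ := h
    · exact ⟨∅, Set.finite_empty, Set.empty_subset _, Or.inl ⟨c, rfl⟩⟩
    · obtain ⟨s, hs, hG, hτ⟩ := ih hτ
      refine ⟨(fun p => (p.1 + 1, p.2)) ⁻¹' s, hs.preimage ?_, ?_,
        Or.inr ⟨n, A, τ, c, rfl, den_mono t M ?_ hτ⟩⟩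
      · rintro ⟨i, σ⟩ _ ⟨j, σ'⟩ _ e
        simpa using e
      · rintro ⟨i, σ⟩ hp
        simpa [graph] using hG hp
      · rintro (_ | i) σ hσ
        · exact hG hσ
        · exact hσ
  | app M N ihM ihN =>
    obtain ⟨n, A, τ, c, hM, hA, rfl⟩ := h
    obtain ⟨s, hs, hG, hM⟩ := ihM hM
    obtain ⟨s', hs', hG', hA⟩ := exists_finite_forall
      (Q := fun i s => A i ∈ den t N (envOf s))
      (fun i s s' h => fun q => den_mono t N (envOf_mono h) q) (fun i => ihN (hA i))
    exact ⟨s ∪ s', hs.union hs', Set.union_subset hG hG', n, A, τ, c,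
      den_mono t M (envOf_mono Set.subset_union_left) hM,
      fun i => den_mono t N (envOf_mono Set.subset_union_right) (hA i), rfl⟩
  | letrec n D M ihD ihM =>
    -- The types obtained from finite parts of `ρ` form a prefixed point, so they contain the least
    -- one.
    let P : Fin n → Set Ty := fun i =>
      {τ | ∃ s, s.Finite ∧ s ⊆ graph ρ ∧ τ ∈ defs t D (envOf s) i}
    have cover : ∀ s' : Set (ℕ × Ty), s'.Finite → s' ⊆ graph (ext P ρ) → ∃ s, s.Finite ∧
        s ⊆ graph ρ ∧ envOf s' ≤ ext (defs t D (envOf s)) (envOf s) := by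
      intro s' hs' hG'
      have := hs'.to_subtype
      obtain ⟨s, hs, hG, h⟩ := exists_finite_forall (ι := s') (G := graph ρ)
        (Q := fun p s => p.1.2 ∈ ext (defs t D (envOf s)) (envOf s) p.1.1)
        (fun p s s' h q => ext_mono (defs_mono t D (envOf_mono h)) (envOf_mono h) _ q) (by
          rintro ⟨⟨i, τ⟩, hp⟩
          have hp := hG' hp
          by_cases hi : i < n
          · simpa [graph, ext, hi, P] using hp
          · refine ⟨{(i - n, τ)}, Set.finite_singleton _, ?_, ?_⟩
            · rintro _ rfl
              simpa [graph, ext, hi] using hp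
            · simp [ext, hi, envOf])
      exact ⟨s, hs, hG, fun i τ hτ => h ⟨(i, τ), hτ⟩⟩
    have hP : defs t D ρ ≤ P := by
      refine defs_le fun i τ hτ => ?_
      obtain ⟨s', hs', hG', hτ⟩ := ihD i hτ
      obtain ⟨s, hs, hG, hle⟩ := cover s' hs' hG'
      refine ⟨s, hs, hG, ?_⟩
      rw [← den_defs]
      exact den_mono t (D i) hle hτ
    obtain ⟨s', hs', hG', hν⟩ := ihM (den_mono t M (ext_mono hP le_rfl) h)
    obtain ⟨s, hs, hG, hle⟩ := cover s' hs' hG'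
    exact ⟨s, hs, hG, den_mono t M hle hν⟩
  | bh => exact h.elim

/-- The expansion half of beta: by continuity, finitely many types of the argument suffice, and
these become the argument types of an arrow of cost `0`. -/
theorem raise_mem_appl_lam {t : ℕ} {M : Exp} {ρ : Env} {Y : Set Ty} {ν : Ty}
    (h : ν ∈ den t M (ext (fun _ : Fin 1 => Y) ρ)) :
    raise t ν ∈ appl t (den t (lam M) ρ) Y := by
  obtain ⟨s, hs, hG, hν⟩ := exists_finite_mem_den h
  have hfin : (envOf s 0).Finite := hs.preimage fun a _ b _ e => by simpa using e
  obtain ⟨n, A, -, hA⟩ := hfin.fin_param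
  refine ⟨n, A, ν, 0, Or.inr ⟨n, A, ν, 0, rfl, den_mono t M ?_ hν⟩, fun i => ?_, by simp⟩
  · rintro (_ | i) σ hσ
    · change σ ∈ Set.range A
      rwa [hA]
    · exact hG hσ
  · have : A i ∈ envOf s 0 := hA ▸ Set.mem_range_self i
    exact hG this

/-- The definition does not mention its own variable, so unfolding the fixed point once computes it.
-/
theorem den_letrec_shift (t : ℕ) (M N : Exp) (ρ : Env) :
    den t (letrec 1 (fun _ => shift 1 N) M) ρ = den t M (ext (fun _ : Fin 1 => den t N ρ) ρ) := by
  rw [den_letrec]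
  congr 2
  funext i
  rw [← den_defs, den_shift_ext]

/-! ### Invariance under reduction -/

theorem den_lift (t n : ℕ) (D : Fin n → Exp) (A N : Exp) (ρ : Env) :
    den t (app (letrec n D A) N) ρ = den t (letrec n D (app A (shift n N))) ρ := by
  simp only [den, den_shift_ext]

theorem den_lift_arg (t n : ℕ) (V : Exp) (D : Fin n → Exp) (A : Exp) (ρ : Env) :
    den t (app V (letrec n D A)) ρ = den t (letrec n D (app (shift n V) A)) ρ := by
  simp only [den, den_shift_ext]

theorem den_deref (t : ℕ) {n : ℕ} (D : Fin n → Exp) (x : Fin n) (E : Ctx) (ρ : Env) :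
    den t (letrec n D (E.plug (var x))) ρ = den t (letrec n D (E.plug (D x))) ρ := by
  rw [den_letrec, den_letrec]
  exact den_plug_congr E (by rw [den_defs, den_var_defs])

/-- Each of the two systems has the least solution of the other as a prefixed point. Since `x ≠ x'`,
the definition of `x'` is the same in both. -/
theorem defs_update_deref (t : ℕ) {n : ℕ} (D : Fin n → Exp) {x x' : Fin n} {F : Ctx}
    (hF : D x = F.plug (var x')) (hx : x ≠ x') (ρ : Env) :
    defs t (Function.update D x (F.plug (D x'))) ρ = defs t D ρ := by
  apply le_antisymm
  · refine defs_le fun i => ?_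
    by_cases hi : i = x
    · subst hi
      rw [Function.update_self]
      refine subset_trans ?_ (den_defs t D ρ i).le
      rw [hF]
      exact den_plug_mono F (by rw [den_defs, den_var_defs])
    · rw [Function.update_of_ne hi, den_defs]
  · refine defs_le fun i => ?_
    refine subset_trans ?_ (den_defs t _ ρ i).le
    by_cases hi : i = x
    · subst hi
      rw [hF, Function.update_self]
      refine den_plug_mono F ?_
      rw [den_var_defs, ← den_defs, Function.update_of_ne hx.symm]
    · rw [Function.update_of_ne hi]

/-- Bekić's principle: a nested least fixed point equals the simultaneous one. -/
theorem defs_flatten (t : ℕ) {n : ℕ} (D : Fin n → Exp) {x : Fin n} {k : ℕ} {D₁ : Fin k → Exp}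
    {A : Exp} (hx : D x = letrec k D₁ A) (ρ : Env) :
    defs t (Fin.append D₁ (Function.update (fun j => shift k (D j)) x A)) ρ =
      Fin.append (defs t D₁ (ext (defs t D ρ) ρ)) (defs t D ρ) := by
  apply le_antisymm
  · refine defs_le fun i => ?_
    rw [ext_append]
    refine Fin.addCases (fun i => ?_) (fun i => ?_) i
    · rw [Fin.append_left, Fin.append_left, den_defs]
    · rw [Fin.append_right, Fin.append_right]
      by_cases hi : i = x
      · subst hi
        rw [Function.update_self, ← den_letrec, ← hx, den_defs]
      · rw [Function.update_of_ne hi, den_shift_ext, den_defs]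
  · set D' := Fin.append D₁ (Function.update (fun j => shift k (D j)) x A) with hD'
    set Z : Fin k → Set Ty := fun i => defs t D' ρ (Fin.castAdd n i)
    set X : Fin n → Set Ty := fun i => defs t D' ρ (Fin.natAdd k i)
    have hZX : defs t D' ρ = Fin.append Z X := (Fin.append_castAdd_natAdd).symm
    have hfix := fun i => den_defs t D' ρ i
    rw [hZX, ext_append] at hfix
    have hfixZ : ∀ i, den t (D₁ i) (ext Z (ext X ρ)) = Z i := fun i => by
      have := hfix (Fin.castAdd n i)
      rwa [hD', Fin.append_left, Fin.append_left] at this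
    have hfixX : ∀ i, den t (Function.update (fun j => shift k (D j)) x A i)
        (ext Z (ext X ρ)) = X i := fun i => by
      have := hfix (Fin.natAdd k i)
      rwa [hD', Fin.append_right, Fin.append_right] at this
    have hZ : defs t D₁ (ext X ρ) ≤ Z := defs_le fun i => (hfixZ i).le
    have hX : defs t D ρ ≤ X := by
      refine defs_le fun i => ?_
      have hi := hfixX i
      by_cases h : i = x
      · subst h
        rw [Function.update_self] at hi
        rw [hx, den_letrec, ← hi]
        exact den_mono t A (ext_mono hZ le_rfl)
      · rw [Function.update_of_ne h, den_shift_ext] at hi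
        exact hi.le
    rw [hZX]
    intro i
    refine Fin.addCases (fun i => ?_) (fun i => ?_) i
    · rw [Fin.append_left, Fin.append_left]
      exact (defs_mono t D₁ (ext_mono hX le_rfl) i).trans (hZ i)
    · rw [Fin.append_right, Fin.append_right]
      exact hX i

theorem den_flatten (t : ℕ) {n : ℕ} (D : Fin n → Exp) (M : Exp) {x : Fin n} {k : ℕ}
    {D₁ : Fin k → Exp} {A : Exp} (hx : D x = letrec k D₁ A) (ρ : Env) :
    den t (flatten D M x D₁ A) ρ = den t (letrec n D M) ρ := by
  rw [flatten, den_letrec, defs_flatten t D hx, ext_append, den_shift_ext, den_letrec]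

theorem den_update_subset (t : ℕ) {n : ℕ} (D : Fin n → Exp) {x : Fin n} {F : Ctx} {N : Exp}
    (hF : D x = F.plug N) (M : Exp) (ρ : Env) :
    den t (letrec n (Function.update D x (F.plug bh)) M) ρ ⊆ den t (letrec n D M) ρ := by
  rw [den_letrec, den_letrec]
  refine den_mono t M (ext_mono (defs_le fun i => ?_) le_rfl)
  refine subset_trans ?_ (den_defs t D ρ i).le
  by_cases hi : i = x
  · subst hi
    rw [hF, Function.update_self]
    exact den_plug_mono F (Set.empty_subset _)
  · rw [Function.update_of_ne hi]

/-- Making the variables of the path empty leaves a prefixed point, since each of their definitions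
is strict in a variable of the path. -/
theorem defs_eq_empty_of_cycle (t : ℕ) {n : ℕ} {D : Fin n → Exp} {m j : ℕ} {x : ℕ → Fin n}
    {F : Ctx} (hD : IsPath .need D m x) (hj : j ≤ m) (hF : IsEval .need F)
    (hm : D (x m) = F.plug (var (x j))) (ρ : Env) {i : ℕ} (hi : i ≤ m) :
    defs t D ρ (x i) = ∅ := by
  classical
  let X : Fin n → Set Ty := fun y => if ∃ i ≤ m, x i = y then ∅ else defs t D ρ y
  have hX0 : ∀ i ≤ m, X (x i) = ∅ := fun i hi => if_pos ⟨i, hi, rfl⟩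
  have hXle : X ≤ defs t D ρ := fun y => by
    dsimp only [X]
    split_ifs
    · exact Set.empty_subset _
    · exact le_rfl
  have hle : defs t D ρ ≤ X := by
    refine defs_le fun y => ?_
    by_cases hy : ∃ i ≤ m, x i = y
    · obtain ⟨i, hi, rfl⟩ := hy
      rw [hX0 i hi, Set.subset_empty_iff]
      obtain hi | rfl := hi.lt_or_eq
      · obtain ⟨F', hF', e⟩ := hD.2 i hi
        rw [e]
        exact den_plug_var_eq_empty hF' (by rw [ext_val, hX0 _ hi])
      · rw [hm]
        exact den_plug_var_eq_empty hF (by rw [ext_val, hX0 _ hj])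
    · rw [show X y = defs t D ρ y from if_neg hy, ← den_defs]
      exact den_mono t (D y) (ext_mono hXle le_rfl)
  exact Set.subset_empty_iff.1 ((hle _).trans (hX0 i hi).le)

theorem den_eq_empty_of_cycle (t : ℕ) {n : ℕ} {D : Fin n → Exp} {m j : ℕ} {x : ℕ → Fin n}
    {F E : Ctx} (hD : IsPath .need D m x) (hj : j ≤ m) (hF : IsEval .need F)
    (hm : D (x m) = F.plug (var (x j))) (hE : IsEval .need E) (ρ : Env) :
    den t (letrec n D (E.plug (var (x 0)))) ρ = ∅ := by
  rw [den_letrec]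
  refine den_plug_var_eq_empty hE ?_
  rw [ext_val, defs_eq_empty_of_cycle t hD hj hF hm ρ (Nat.zero_le m)]

theorem Redex.den_value {R R' : Exp} (h : Redex .value R R') (ρ : Env) :
    den 0 R' ρ ⊆ den 0 R ρ := by
  cases h with
  | beta_need _ _ h => cases h
  | beta_value M M' _ =>
    rw [den_letrec_shift]
    intro ν hν
    rw [← raise_zero ν]
    exact raise_mem_appl_lam hν
  | lift n D A N _ => exact (den_lift ..).ge
  | lift_arg V n D A _ _ _ => exact (den_lift_arg ..).ge
  | deref D x E _ _ => exact (den_deref ..).ge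
  | deref_env D m x x' F E _ _ _ hF hx _ =>
    rw [den_letrec, defs_update_deref 0 D hF (hx m le_rfl), den_letrec]
  | assoc D x E k D₁ A _ _ h => exact (den_flatten 0 D _ h ρ).le
  | assoc_env D m x E k D₁ A _ _ _ _ h => exact (den_flatten 0 D _ h ρ).le
  | error D m x F E _ _ _ h => exact den_update_subset 0 D h _ ρ
  | error_env D m x j F E _ _ _ _ _ h => exact den_update_subset 0 D h _ ρ
  | error_beta M => exact Set.empty_subset _
  | error_arg M _ => exact Set.empty_subset _

theorem Step.den_value {M M' : Exp} (h : Step .value M M') (ρ : Env) :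
    den 0 M' ρ ⊆ den 0 M ρ := by
  obtain ⟨E, R, R', -, hR, rfl, rfl⟩ := h
  exact den_fill_mono E le_rfl fun η η' hη _ _ => (hR.den_value η).trans (den_mono 0 R hη)

theorem Steps.den_value {M M' : Exp} (h : Steps .value M M') (ρ : Env) :
    den 0 M' ρ ⊆ den 0 M ρ := by
  induction h with
  | refl => exact subset_rfl
  | tail _ h ih => exact (h.den_value ρ).trans ih

theorem Exp.IsGoodAnswer.base_mem_den {t : ℕ} {G : Exp} (h : G.IsGoodAnswer)
    (ρ : Env) : base 0 ∈ den t G ρ := by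
  induction h generalizing ρ with
  | lam M => exact Or.inl ⟨0, rfl⟩
  | letrec n D _ ih => exact ih _

/-! ### Adequacy of the costs -/

/-- The set `X` of types of the model with costs behaves as the type, up to costs. -/
def Realizes : Ty → Set Ty → Prop
  | base _, X => ∃ c, base c ∈ X
  | arr _ A τ _, X => ∀ Y, (∀ i, Realizes (A i) Y) → Realizes τ (appl 1 X Y)

theorem realizes_raise {k : ℕ} {τ : Ty} {X : Set Ty} : Realizes (raise k τ) X ↔ Realizes τ X := by
  cases τ <;> rfl

/-- The relation tolerates a uniform extra cost, such as the unit charged for applying an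
abstraction at `t = 1`. -/
theorem Realizes.of_raise {τ : Ty} {X X' : Set Ty} {k : ℕ} (h : Realizes τ X)
    (hX : ∀ ν ∈ X, raise k ν ∈ X') : Realizes τ X' := by
  induction τ generalizing X X' with
  | base c =>
    obtain ⟨c, hc⟩ := h
    exact ⟨_, hX _ hc⟩
  | arr n A τ c _ ih =>
    intro Y hY
    refine ih (h Y hY) ?_
    rintro _ ⟨n, A, σ, c, hS, hA, rfl⟩
    refine ⟨n, A, σ, c + k, hX _ hS, hA, ?_⟩
    rw [raise_raise]
    congr 1
    omega

theorem Realizes.mono {τ : Ty} {X X' : Set Ty} (h : Realizes τ X) (hX : X ⊆ X') :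
    Realizes τ X' :=
  h.of_raise (k := 0) fun ν hν => by simpa using hX hν

/-- The fundamental lemma of the logical relation. -/
theorem realizes_den {M : Exp} {ρ ρ' : Env} (hρ : ∀ i, ∀ τ ∈ ρ i, Realizes τ (ρ' i)) {ν : Ty}
    (h : ν ∈ den 0 M ρ) : Realizes ν (den 1 M ρ') := by
  have hext : ∀ {n : ℕ} {X X' : Fin n → Set Ty} {ρ ρ' : Env},
      (∀ i, ∀ τ ∈ X i, Realizes τ (X' i)) → (∀ i, ∀ τ ∈ ρ i, Realizes τ (ρ' i)) →
      ∀ i, ∀ τ ∈ ext X ρ i, Realizes τ (ext X' ρ' i) := by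
    intro n X X' ρ ρ' hX hρ i
    by_cases hi : i < n
    · simpa [ext, hi] using hX _
    · simpa [ext, hi] using hρ _
  induction M generalizing ρ ρ' ν with
  | var i =>
    obtain ⟨τ, hτ, k, rfl⟩ := h
    exact realizes_raise.2 ((hρ i τ hτ).mono (subset_up _))
  | lam M ih =>
    obtain ⟨c, rfl⟩ | ⟨n, A, τ, c, rfl, hτ⟩ := h
    · exact ⟨0, Or.inl ⟨0, rfl⟩⟩
    · intro Y hY
      have hM : Realizes τ (den 1 M (ext (fun _ : Fin 1 => Y) ρ')) := by
        refine ih (hext ?_ hρ) hτ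
        rintro _ _ ⟨i, rfl⟩
        exact hY i
      exact hM.of_raise fun ν hν => raise_mem_appl_lam hν
  | app M N ihM ihN =>
    obtain ⟨n, A, τ, c, hM, hA, rfl⟩ := h
    exact realizes_raise.2 (ihM hρ hM _ fun i => ihN hρ (hA i))
  | letrec n D M ihD ihM =>
    -- The types realized by the solution at `t = 1` form a prefixed point of the operator at `t =
    -- 0`.
    have hX : defs 0 D ρ ≤ fun i => {τ | Realizes τ (defs 1 D ρ' i)} := by
      refine defs_le fun i τ hτ => ?_
      have := ihD i (hext (X' := defs 1 D ρ') (fun _ _ h => h) hρ) hτ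
      rwa [den_defs] at this
    exact ihM (hext (fun i _ hτ => hX i hτ) hρ) h
  | bh => exact h.elim

/-! ### Call-by-need reduction terminates -/

/-- A measure of expressions that is decreased by all the rules of the call-by-need calculus other
than beta. -/
def weight : Exp → ℕ
  | var _ => 2
  | lam _ => 1
  | app M N => 2 * weight M + weight N
  | letrec _ D M => 1 + ∑ i, weight (D i) + weight M
  | bh => 1

theorem weight_pos (M : Exp) : 0 < weight M := by
  induction M <;> simp only [weight] <;> omega

theorem weight_rename (M : Exp) (f : ℕ → ℕ) : weight (rename f M) = weight M := by
  induction M generalizing f with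
  | app M N ihM ihN => simp only [rename, weight, ihM, ihN]
  | letrec n D M ihD ihM => simp only [rename, weight, ihM, ihD]
  | _ => rfl

theorem weight_shift (M : Exp) (k : ℕ) : weight (shift k M) = weight M := weight_rename M _

theorem sum_weight_update {n : ℕ} (D : Fin n → Exp) (x : Fin n) (N : Exp) :
    ∑ i, weight (Function.update D x N i) + weight (D x) = ∑ i, weight (D i) + weight N := by
  have e : ∀ D : Fin n → Exp, ∑ i, weight (D i) =
      weight (D x) + ∑ i ∈ Finset.univ.erase x, weight (D i) :=
    fun D => (Finset.add_sum_erase _ _ (Finset.mem_univ x)).symm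
  have h : ∑ i ∈ Finset.univ.erase x, weight (Function.update D x N i) =
      ∑ i ∈ Finset.univ.erase x, weight (D i) :=
    Finset.sum_congr rfl fun i hi => by rw [Function.update_of_ne (Finset.ne_of_mem_erase hi)]
  rw [e, e D, h, Function.update_self]
  omega

theorem weight_fill_lt (E : Ctx) {N N' : Exp} (h : weight N' < weight N) :
    weight (E.fill N') < weight (E.fill N) := by
  induction E with
  | hole => exact h
  | appL E M ih => simp only [Ctx.fill, weight]; omega
  | appR M E ih => simp only [Ctx.fill, weight]; omega
  | letBody n D E ih => simp only [Ctx.fill, weight]; omega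
  | letDef n D i E M ih =>
    have h₁ := sum_weight_update D i (E.fill N)
    have h₂ := sum_weight_update D i (E.fill N')
    simp only [Ctx.fill, weight]
    omega

theorem weight_plug_lt (E : Ctx) {N N' : Exp} (h : weight N' < weight N) :
    weight (E.plug N') < weight (E.plug N) :=
  weight_fill_lt E (by rwa [weight_shift, weight_shift])

theorem weight_letrec_update_lt {n : ℕ} (D : Fin n → Exp) {x : Fin n} {F : Ctx} {N N' : Exp}
    (hF : D x = F.plug N) (h : weight N' < weight N) (M : Exp) :
    weight (letrec n (Function.update D x (F.plug N')) M) < weight (letrec n D M) := by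
  have h₁ := sum_weight_update D x (F.plug N')
  have h₂ := weight_plug_lt F h
  rw [hF] at h₁
  simp only [weight]
  omega

/-- The inner `let rec` disappears, and with it its summand `1`. -/
theorem weight_flatten_lt {n : ℕ} (D : Fin n → Exp) (M : Exp) {x : Fin n} {k : ℕ}
    {D₁ : Fin k → Exp} {A : Exp} (hx : D x = letrec k D₁ A) :
    weight (flatten D M x D₁ A) < weight (letrec n D M) := by
  have h := sum_weight_update (fun j => shift k (D j)) x A
  simp only [weight_shift, hx] at h
  simp only [flatten, weight, Fin.sum_univ_add, Fin.append_left, Fin.append_right,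
    weight_shift] at h ⊢
  omega

/-- Bodies of abstractions are not counted, so a value is lighter than the variable it replaces and
copying it is free. -/
theorem Exp.IsValue.weight_eq {V : Exp} (h : V.IsValue) : weight V = 1 := by
  cases h <;> rfl

theorem Redex.den_need {R R' : Exp} (h : Redex .need R R') :
    ((∀ ρ, den 1 R ρ ⊆ den 1 R' ρ) ∧ weight R' < weight R) ∨
      ∀ ρ, den 1 R ρ ⊆ den 1 R' ρ ∧ ∀ ν ∈ den 1 R ρ, ∃ μ ∈ den 1 R' ρ, ν = raise 1 μ := by
  cases h with
  | beta_need M N _ =>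
    right
    intro ρ
    have key : ∀ ν ∈ den 1 (app (lam M) N) ρ,
        ∃ μ ∈ den 1 (letrec 1 (fun _ => shift 1 N) M) ρ, ν = raise 1 μ := by
      rintro _ ⟨n, A, τ, c, ⟨c', h⟩ | ⟨n', A', τ', c', h, hτ⟩, hA, rfl⟩
      · cases h
      · cases h
        -- The cost is `c + 1`: `c` comes from the arrow, and the `1` from the application that beta
        -- removes.
        refine ⟨raise c τ, ?_, (raise_raise _ _ _).symm⟩
        rw [den_letrec_shift]
        refine isUp_den _ _ _ _ (den_mono 1 M (ext_mono ?_ le_rfl) hτ) c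
        rintro _ _ ⟨i, rfl⟩
        exact hA i
    refine ⟨fun ν hν => ?_, key⟩
    obtain ⟨μ, hμ, rfl⟩ := key ν hν
    exact isUp_den _ _ _ _ hμ 1
  | beta_value _ _ h => cases h
  | lift n D A N _ =>
    refine Or.inl ⟨fun ρ => (den_lift ..).le, ?_⟩
    have := weight_pos A
    -- The factor `2` on the function position counts `D` and its `let rec` twice before the lift
    -- and once after it.
    simp only [weight, weight_shift]
    omega
  | lift_arg _ _ _ _ h => cases h
  | deref D x E _ hx =>
    refine Or.inl ⟨fun ρ => (den_deref ..).le, ?_⟩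
    have := weight_plug_lt E (N := var x) (N' := D x) (by simp [hx.weight_eq, weight])
    simp only [weight]
    omega
  | deref_env D m x x' F E _ _ _ hF hx hV =>
    refine Or.inl ⟨fun ρ => ?_, weight_letrec_update_lt D hF (by simp [hV.weight_eq, weight]) _⟩
    rw [den_letrec, den_letrec, defs_update_deref 1 D hF (hx m le_rfl)]
  | assoc D x E k D₁ A _ _ h =>
    exact Or.inl ⟨fun ρ => (den_flatten 1 D _ h ρ).ge, weight_flatten_lt D _ h⟩
  | assoc_env D m x E k D₁ A _ _ _ _ h =>
    exact Or.inl ⟨fun ρ => (den_flatten 1 D _ h ρ).ge, weight_flatten_lt D _ h⟩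
  | error D m x F E hE hD hF h =>
    refine Or.inl ⟨fun ρ => ?_, weight_letrec_update_lt D h (by simp [weight]) _⟩
    rw [den_eq_empty_of_cycle 1 hD (Nat.zero_le m) hF h hE]
    exact Set.empty_subset _
  | error_env D m x j F E hE _ hj hD hF h =>
    refine Or.inl ⟨fun ρ => ?_, weight_letrec_update_lt D h (by simp [weight]) _⟩
    rw [den_eq_empty_of_cycle 1 hD hj hF h hE]
    exact Set.empty_subset _
  | error_beta M =>
    refine Or.inl ⟨fun ρ => (appl_empty _ _).le, ?_⟩
    simp only [weight]
    omega
  | error_arg _ h => cases h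

theorem Step.den_need {M M' : Exp} (h : Step .need M M') :
    ((∀ ρ, den 1 M ρ ⊆ den 1 M' ρ) ∧ weight M' < weight M) ∨
      ∀ ρ, den 1 M ρ ⊆ den 1 M' ρ ∧ ∀ ν ∈ den 1 M ρ, ∃ μ ∈ den 1 M' ρ, ν = raise 1 μ := by
  obtain ⟨E, R, R', hE, hR, rfl, rfl⟩ := h
  refine hR.den_need.imp ?_ ?_
  · rintro ⟨h, hw⟩
    exact ⟨fun ρ => den_fill_mono E le_rfl fun η η' hη _ _ => (h η).trans (den_mono 1 R' hη),
      weight_fill_lt E hw⟩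
  · refine fun h ρ => (strictRel_tick 1).den_fill hE le_rfl fun η η' hη _ _ =>
      ⟨(h η).1.trans (den_mono 1 R' hη), fun ν hν => ?_⟩
    obtain ⟨μ, hμ, e⟩ := (h η).2 ν hν
    exact ⟨μ, den_mono 1 R' hη hμ, e⟩

/-! ### Progress -/

/-- Expressions that demand the value of a free variable. -/
def IsStuck (M : Exp) : Prop := ∃ E i, IsEval .need E ∧ M = Ctx.plug E (var i)

theorem Step.of_redex {s : Strategy} {R R' : Exp} (h : Redex s R R') : Step s R R' :=
  ⟨.hole, R, R', .hole, h, rfl, rfl⟩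

theorem IsPath.snoc {s : Strategy} {n : ℕ} {D : Fin n → Exp} {m : ℕ} {x : ℕ → Fin n}
    (hx : IsPath s D m x) {y : Fin n} (hy : ∀ i ≤ m, x i ≠ y) {F : Ctx} (hF : IsEval s F)
    (h : D (x m) = F.plug (var y)) : IsPath s D (m + 1) (Function.update x (m + 1) y) := by
  have hne : ∀ i ≤ m, Function.update x (m + 1) y i = x i :=
    fun i hi => Function.update_of_ne (by omega) _ _
  have hlast : Function.update x (m + 1) y (m + 1) = y := Function.update_self ..
  constructor
  · intro i j hi hj e
    obtain hi | rfl := Nat.le_succ_iff.1 hi <;> obtain hj | rfl := Nat.le_succ_iff.1 hj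
    · rw [hne i hi, hne j hj] at e
      exact hx.1 i j hi hj e
    · rw [hne i hi, hlast] at e
      exact (hy i hi e).elim
    · rw [hne j hj, hlast] at e
      exact (hy j hj e.symm).elim
    · rfl
  · intro i hi
    rw [hne i (by omega)]
    obtain hi | rfl := (Nat.lt_succ_iff.1 hi).lt_or_eq
    · rw [hne (i + 1) hi]
      exact hx.2 i hi
    · rw [hlast]
      exact ⟨F, hF, h⟩

theorem IsPath.lt {s : Strategy} {n : ℕ} {D : Fin n → Exp} {m : ℕ} {x : ℕ → Fin n}
    (hx : IsPath s D m x) : m < n := by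
  have := Fintype.card_le_of_injective (fun i : Fin (m + 1) => x i) fun i j h =>
    Fin.ext (hx.1 i j (by omega) (by omega) h)
  simpa using this

theorem IsPath.isEval_letDef {s : Strategy} {n : ℕ} {D : Fin n → Exp} {m : ℕ} {x : ℕ → Fin n}
    (hx : IsPath s D m x) {E C : Ctx} (hE : IsEval s E) (hC : IsEval s C) :
    IsEval s (.letDef n D (x m) C (E.plug (var (x 0)))) := by
  choose F hF hF' using hx.2
  -- The value `.hole` from `m` on is never used.
  refine .dep D m x (fun i => if h : i < m then F i h else .hole) hx.1 ?_ ?_ hC hE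
  · intro i hi
    simpa [hi] using hF i hi
  · intro i hi
    simpa [hi] using hF' i hi

/-- The chain of demands is followed from `x 0`. If the last definition demands a bound variable,
either this variable closes a cycle and an error rule applies, or it prolongs the path, which
happens at most `n` times. A demand for a variable from outside makes the whole expression stuck. -/
theorem progress_of_path {n : ℕ} {D : Fin n → Exp} {E : Ctx} (hE : IsEval .need E)
    (hD : ∀ i, (D i).IsAnswer ∨ (∃ N, Step .need (D i) N) ∨ IsStuck (D i))
    {m : ℕ} {x : ℕ → Fin n} (hx : IsPath .need D m x) :
    (∃ N, Step .need (letrec n D (E.plug (var (x 0)))) N) ∨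
      IsStuck (letrec n D (E.plug (var (x 0)))) := by
  induction hk : n - m using Nat.strong_induction_on generalizing m x with
  | _ k ih =>
  have hfill : ∀ {C : Ctx} {N : Exp}, D (x m) = C.fill N →
      letrec n D (E.plug (var (x 0))) =
        (Ctx.letDef n D (x m) C (E.plug (var (x 0)))).fill N := by
    intro C N h
    rw [Ctx.fill, ← h, Function.update_eq_self]
  obtain hA | ⟨N, C, R, R', hC, hR, e, rfl⟩ | ⟨C, i, hC, e⟩ := hD (x m)
  · left
    generalize hV : D (x m) = V at hA
    cases hA with
    | value hV' =>
      rw [← hV] at hV'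
      obtain rfl | hm := Nat.eq_zero_or_pos m
      · exact ⟨_, .of_redex (.deref D (x 0) E hE hV')⟩
      -- In `deref_env` the path stops one variable earlier: its last definition is the one that
      -- contains the occurrence to be replaced.
      · obtain ⟨F, hF, e⟩ := hx.2 (m - 1) (by omega)
        rw [Nat.sub_add_cancel hm] at e
        refine ⟨_, .of_redex (.deref_env D (m - 1) x (x m) F E hE ⟨?_, ?_⟩ hF e ?_ hV')⟩
        · exact fun i j hi hj => hx.1 i j (by omega) (by omega)
        · exact fun i hi => hx.2 i (by omega)
        · intro i hi h
          have := hx.1 _ _ (by omega) le_rfl h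
          omega
    | letrec l D₁ hA =>
      obtain rfl | hm := Nat.eq_zero_or_pos m
      · exact ⟨_, .of_redex (.assoc D (x 0) E l D₁ _ hE hA hV)⟩
      · exact ⟨_, .of_redex (.assoc_env D m x E l D₁ _ hE hm hx hA hV)⟩
  · exact Or.inl ⟨_, _, R, R', hx.isEval_letDef hE hC, hR, hfill e, rfl⟩
  · by_cases hi : i < n
    · by_cases hj : ∃ j ≤ m, x j = ⟨i, hi⟩
      · left
        obtain ⟨j, hj, h⟩ := hj
        have e : D (x m) = C.plug (var (x j)) := by rw [e, h]
        obtain rfl | hj0 := Nat.eq_zero_or_pos j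
        · exact ⟨_, .of_redex (.error D m x C E hE hx hC e)⟩
        · exact ⟨_, .of_redex (.error_env D m x j C E hE hj0 hj hx hC e)⟩
      · have hx' := hx.snoc (y := ⟨i, hi⟩) (fun j hj' h => hj ⟨j, hj', h⟩) hC e
        have hlt := hx'.lt
        have := ih _ (by omega) hx' rfl
        rwa [Function.update_of_ne (Nat.succ_ne_zero m).symm] at this
    · right
      refine ⟨_, i - n, hx.isEval_letDef hE hC, ?_⟩
      rw [Ctx.plug]
      refine hfill ?_
      rw [e, Ctx.plug]
      simp only [shift, rename, Ctx.depth]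
      congr 2
      omega

/-- Stated for open expressions, because the induction goes into the definitions and bodies of `let
rec`. -/
theorem progress (M : Exp) : M.IsAnswer ∨ (∃ N, Step .need M N) ∨ IsStuck M := by
  induction M with
  | var i => exact Or.inr (Or.inr ⟨.hole, i, .hole, rfl⟩)
  | lam M => exact Or.inl (.value (.lam M))
  | bh => exact Or.inl (.value .bh)
  | app M N ih _ =>
    right
    obtain hA | ⟨_, C, R, R', hC, hR, rfl, rfl⟩ | ⟨C, i, hC, rfl⟩ := ih
    · left
      cases hA with
      | value hV =>
        cases hV with
        | lam M => exact ⟨_, .of_redex (.beta_need M N rfl)⟩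
        | bh => exact ⟨_, .of_redex (.error_beta N)⟩
      | letrec n D hA => exact ⟨_, .of_redex (.lift n D _ N hA)⟩
    · exact Or.inl ⟨_, _, R, R', .appL N hC, hR, rfl, rfl⟩
    · exact Or.inr ⟨_, i, .appL N hC, rfl⟩
  | letrec n D M ihD ihM =>
    obtain hA | ⟨_, C, R, R', hC, hR, rfl, rfl⟩ | ⟨C, i, hC, rfl⟩ := ihM
    · exact Or.inl (.letrec n D hA)
    · exact Or.inr (Or.inl ⟨_, _, R, R', .letBody n D hC, hR, rfl, rfl⟩)
    · right
      by_cases hi : i < n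
      · exact progress_of_path hC ihD (m := 0) (x := fun _ => ⟨i, hi⟩)
          ⟨fun _ _ h h' _ => by omega, fun _ h => by omega⟩
      · refine Or.inr ⟨_, i - n, .letBody n D hC, ?_⟩
        simp only [Ctx.plug, Ctx.fill, shift, rename, Ctx.depth]
        congr 3
        omega

/-! ### From types to call-by-need good answers -/

theorem Exp.IsAnswer.isGoodAnswer {t : ℕ} {M : Exp} (hM : M.IsAnswer) {ρ : Env}
    (h : (den t M ρ).Nonempty) : M.IsGoodAnswer := by
  induction hM generalizing ρ with
  | value hV =>
    cases hV with
    | lam M => exact .lam M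
    | bh => exact (Set.not_nonempty_empty h).elim
  | letrec n D _ ih => exact .letrec n D (ih h)

theorem IsStuck.den_eq_empty {t : ℕ} {M : Exp} (h : IsStuck M) :
    den t M (fun _ => ∅) = ∅ := by
  obtain ⟨E, i, hE, rfl⟩ := h
  exact den_plug_var_eq_empty hE rfl

theorem exists_goodAnswer_of_base_mem_den (c : ℕ) (M : Exp)
    (h : base c ∈ den 1 M fun _ => ∅) : ∃ G : Exp, G.IsGoodAnswer ∧ Steps .need M G := by
  obtain hA | ⟨N, hN⟩ | hS := progress M
  · exact ⟨M, hA.isGoodAnswer ⟨_, h⟩, .refl⟩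
  · obtain ⟨hle, hw⟩ | hlt := hN.den_need
    · obtain ⟨G, hG, hNG⟩ := exists_goodAnswer_of_base_mem_den c N (hle _ h)
      exact ⟨G, hG, .head hN hNG⟩
    -- After beta the weight may grow, but the cost drops from `c' + 1` to `c'`.
    · obtain ⟨μ, hμ, e⟩ := (hlt _).2 _ h
      cases μ with
      | arr => cases e
      | base c' =>
        have hc : c = c' + 1 := by simpa [raise] using e
        obtain ⟨G, hG, hNG⟩ := exists_goodAnswer_of_base_mem_den c' N hμ
        exact ⟨G, hG, .head hN hNG⟩
  · rw [hS.den_eq_empty] at h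
    exact h.elim
termination_by (c, weight M)

end Letrec

theorem mainTheorem5 (M G : Letrec.Exp) (hM : M.IsProgram) (hG : G.IsGoodAnswer)
    (h : Letrec.Steps Letrec.Strategy.value M G) :
    ∃ G' : Letrec.Exp, G'.IsGoodAnswer ∧ Letrec.Steps Letrec.Strategy.need M G' := by
  obtain ⟨c, hc⟩ := Letrec.realizes_den (ρ := fun _ => ∅) (ρ' := fun _ => ∅)
    (fun _ _ hτ => hτ.elim) (h.den_value _ (hG.base_mem_den _))
  exact Letrec.exists_goodAnswer_of_base_mem_den c M hc
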